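/- **Proposition 2 (Bounds and average effective resistance).** Let $\bar G$ be a finite connected simple undirected graph on $N$ nodes with adjacency matrix $\bar A$, Laplacian $\bar L$ with eigenvalues $0=\lambda_1(\bar L)<\lambda_2(\bar L)\le\dots\le\lambda_N(\bar L)$ (with multiplicity) and maximum degree $d_{\max}$. Let $0<p\le 1$, let $\varepsilon>0$ with $k:=\varepsilon d_{\max}<1$, and let $\sigma\in\mathbb R$. Let $\gamma_i(t)$ ($1\le i\le N$, $t\in\mathbb N$) be jointly independent random variables with $\Pr(\gamma_i(t)=1)=p$ and $\Pr(\gamma_i(t)=0)=1-p$, and put $$\Gamma(t)=\mathrm{diag}[\gamma_1(t),\dots,\gamma_N(t)],\qquad A(t)=\Gamma(t)\bar A\,\Gamma(t),\qquad P(t)=I_N-\varepsilon\,(D(t)-A(t)),$$ where $D(t)$ is the diagonal matrix of the row sums of $A(t)$; the matrices $P(t)$ are called randomly induced discretized Laplacians (RIDL). Let $n(t)\in\mathbb R^N$, $t\in\mathbb N$, be random vectors whose entries $n_i(t)$ are square integrable with mean zero and variance $\sigma^2$ and are uncorrelated with respect to both $i$ and $t$, and let the process $(n(t))_t$ be independent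 of the process $(\gamma(t))_t$. For a deterministic initial state $x(0)\in\mathbb R^N$ let $x(t+1)=P(t)x(t)+n(t)$. Then the limit $$J_{\mathrm{noise}}=\frac1N\lim_{t\to\infty}\mathbb E\bigl[\|x(t)-N^{-1}\mathbb 1\mathbb 1^{T}x(t)\|^2\bigr]$$ exists (all these expectations being finite), and $$\frac{\sigma^2}{2p^2}\,\frac{R_{\mathrm{ave}}}{\varepsilon}\;\le\; J_{\mathrm{noise}}\;\le\;\frac{\sigma^2}{2p^3(1-k)}\,\frac{R_{\mathrm{ave}}}{\varepsilon},\qquad R_{\mathrm{ave}}:=\frac1N\sum_{i=2}^N\frac1{\lambda_i(\bar L)}.$$ Moreover, consider a sequence of such systems in which the number $N$ of nodes tends to infinity, while $\sigma>0$, $0<p\le1$ and $0<k<1$ are fixed; the graph $\bar G$ varies along the sequence and $\varepsilon=k/d_{\max}$ (where $d_{\max}>0$). Then, for every member of the sequence, $$\frac{\sigma^2}{2p^2k}\,d_{\max}R_{\mathrm{ave}}\;\le\; J_{\mathrm{noise}}\;\le\;\frac{\sigma^2}{2p^3k(1-k)}\,d_{\max}R_{\mathrm{ave}}.$$ Hence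 $J_{\mathrm{noise}}=\Theta(d_{\max}R_{\mathrm{ave}})$ as $N\to\infty$, and the bounds are asymptotically tight in the sense that $J_{\mathrm{noise}}$ is of the same order of growth ($\Theta$) as the lower bound and as the upper bound. -/

import Mathlib

open MeasureTheory ProbabilityTheory Filter Topology Asymptotics
open scoped Matrix

noncomputable section

namespace NoisyConsensus

variable {V Ω : Type*}

/-- The random activations: `γ t i` is the state of node `i` at time `t`; all of these are
jointly independent Bernoulli variables, equal to `1` (active) with probability `p` and to `0`
with probability `1 - p`. -/
structure IsActivation [MeasurableSpace Ω] (μ : Measure Ω) (p : unitInterval)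
    (γ : ℕ → V → Ω → ℝ) : Prop where
  law : ∀ t i, HasLaw (γ t i) (bernoulliMeasure (1 : ℝ) 0 p) μ
  indep : iIndepFun (fun ti : ℕ × V => γ ti.1 ti.2) μ

/-- Noise `n t i` (time `t`, node `i`) with finite second moments, zero mean, variance `σ ^ 2`,
and uncorrelated with respect to both time and node. -/
structure IsWhiteNoise [MeasurableSpace Ω] (μ : Measure Ω) (σ : ℝ)
    (n : ℕ → V → Ω → ℝ) : Prop where
  memLp : ∀ t i, MemLp (n t i) 2 μ
  mean : ∀ t i, ∫ ω, n t i ω ∂μ = 0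
  variance : ∀ t i, ProbabilityTheory.variance (n t i) μ = σ ^ 2
  uncorrelated : ∀ t i s j, (t, i) ≠ (s, j) →
    ProbabilityTheory.covariance (n t i) (n s j) μ = 0

/-- The squared Euclidean distance `‖x - N⁻¹ 𝟙 𝟙ᵀ x‖²` of `x` from its consensus point. -/
def sqDeviation [Fintype V] (x : V → ℝ) : ℝ :=
  ∑ i, (x i - (∑ j, x j) / Fintype.card V) ^ 2

variable [Fintype V] [DecidableEq V]

/-- The adjacency matrix `A = Γ Ā Γ` of the subgraph of `G` induced by the active nodes, where
`Γ = diag γ`, `γ` is the 0-1 vector of node states and `Ā` is the adjacency matrix of `G`. -/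
def activeAdj (G : SimpleGraph V) [DecidableRel G.Adj] (γ : V → ℝ) : Matrix V V ℝ :=
  Matrix.diagonal γ * G.adjMatrix ℝ * Matrix.diagonal γ

/-- The Laplacian `L = D - A` of the active subgraph; `D` is the diagonal matrix of degrees. -/
def activeLap (G : SimpleGraph V) [DecidableRel G.Adj] (γ : V → ℝ) : Matrix V V ℝ :=
  Matrix.diagonal (fun i => ∑ j, activeAdj G γ i j) - activeAdj G γ

/-- The randomly induced discretized Laplacian `P = I - ε (D - A)`. -/
def ridl (G : SimpleGraph V) [DecidableRel G.Adj] (ε : ℝ) (γ : V → ℝ) : Matrix V V ℝ :=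
  1 - ε • activeLap G γ

/-- The trajectory of the noisy dynamics `x (t + 1) = P (t) x (t) + n (t)` with initial state
`x₀`, where `P (t)` is the randomly induced discretized Laplacian at time `t`. -/
def state (G : SimpleGraph V) [DecidableRel G.Adj] (ε : ℝ) (γ n : ℕ → V → Ω → ℝ) (x₀ : V → ℝ) :
    ℕ → Ω → V → ℝ
  | 0, _ => x₀
  | t + 1, ω => ridl G ε (fun i => γ t i ω) *ᵥ state G ε γ n x₀ t ω + fun i => n t i ω

/-- The normalized mean square deviation from consensus at time `t`. -/
def meanSqDeviation [MeasurableSpace Ω] (μ : Measure Ω) (G : SimpleGraph V) [DecidableRel G.Adj]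
    (ε : ℝ) (γ n : ℕ → V → Ω → ℝ) (x₀ : V → ℝ) (t : ℕ) : ℝ :=
  (1 / (Fintype.card V : ℝ)) * ∫ ω, sqDeviation (state G ε γ n x₀ t ω) ∂μ

/-- The noise index `J_noise`: the limit as `t → ∞` of the normalized mean square deviation. -/
def noiseIndex [MeasurableSpace Ω] (μ : Measure Ω) (G : SimpleGraph V) [DecidableRel G.Adj]
    (ε : ℝ) (γ n : ℕ → V → Ω → ℝ) (x₀ : V → ℝ) : ℝ :=
  limUnder atTop (meanSqDeviation μ G ε γ n x₀)

/-- The eigenvalues of the Laplacian of `G`, with multiplicity, in increasing order and indexed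
from `0` (Mathlib's `eigenvalues₀` is decreasing). -/
def lapEigenvalue (G : SimpleGraph V) [DecidableRel G.Adj] (i : Fin (Fintype.card V)) : ℝ :=
  (G.isHermitian_lapMatrix ℝ).eigenvalues₀ (Fin.rev i)

/-- The average effective resistance `N⁻¹ ∑_{i ≥ 2} 1 / λ_i`, where `λ_1 ≤ … ≤ λ_N` are the
Laplacian eigenvalues; the sum leaves out the smallest one, which has index `0` here. -/
def avgResistance (G : SimpleGraph V) [DecidableRel G.Adj] : ℝ :=
  (1 / (Fintype.card V : ℝ)) *
    ∑ i ∈ (Finset.univ : Finset (Fin (Fintype.card V))).filter (fun i => 0 < i.val),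
      1 / lapEigenvalue G i

/-- The lower bound for the noise index in terms of the average effective resistance. -/
def lowerBound (G : SimpleGraph V) [DecidableRel G.Adj] (σ p ε : ℝ) : ℝ :=
  σ ^ 2 / (2 * p ^ 2) * (avgResistance G / ε)

/-- The upper bound for the noise index in terms of the average effective resistance; here
`k = ε * d_max`. -/
def upperBound (G : SimpleGraph V) [DecidableRel G.Adj] (σ p ε : ℝ) : ℝ :=
  σ ^ 2 / (2 * p ^ 3 * (1 - ε * G.maxDegree)) * (avgResistance G / ε)

end NoisyConsensus

end

/-!
Let `Π = I - N⁻¹ 𝟙 𝟙ᵀ`, let `L̄` be the Laplacian of `G`, let `L` be the random Laplacian of one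
step, and let `M X = E[P X P]` with `P = I - ε L` be the mean action of one step on second-moment
matrices (`meanConj`). The noise is white and independent of the activations, and the activations
at time `t` are independent of the past; hence the second-moment matrix of the state satisfies
`E[x(t+1) x(t+1)ᵀ] = M (E[x(t) x(t)ᵀ]) + σ² I` (`meanStateMoment_succ`), and the mean squared
deviation is `tr(Π Mᵗ(x₀ x₀ᵀ)) + σ² ∑_{s < t} tr(Π Mˢ(I))` (`meanSqDeviation_eq`). Both follow by
averaging first over the noise, with the activations frozen (`integral_sqDeviation`), which
needs no more of the noise than its first two moments.

The Lyapunov function of the recursion is `X ↦ tr(L̄⁺ X)`, where `L̄⁺` is the pseudo-inverse of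
`L̄`. Since `E[L] = p² L̄` and `L̄ L̄⁺ = Π` on a connected graph, for positive semidefinite `X`
`tr(L̄⁺ M X) = tr(L̄⁺ X) - 2 ε p² tr(Π X) + ε² E[tr(X L L̄⁺ L)]`. The last term is nonnegative, and
`0 ≤ L ≤ L̄` gives `L L̄⁺ L ≤ L` (`posSemidef_sub_mul_lapPinv_mul`), so that together with
`L̄ ≤ 2 d_max Π` it is at most `2 ε² p² d_max tr(Π X)`. Thus one step lowers `tr(L̄⁺ X)` by at least
`2 ε p² (1 - ε d_max) tr(Π X)` and by at most `2 ε p² tr(Π X)`. Telescoping shows that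
`tr(Π Mᵗ X)` is summable, with sum between `tr(L̄⁺ X)` divided by these two factors
(`summable_of_lyapunov`). In particular the contribution of `x₀` vanishes in the limit, and for
`X = I` the trace is `tr L̄⁺ = ∑_{i ≥ 2} 1 / λ_i = N R_ave`, which yields both bounds; the upper one
even with `p²` in the place of `p³`.
-/

noncomputable section

namespace NoisyConsensus

section

variable {V : Type*} [Fintype V]

/-! ### Positive semidefinite matrices and the centering projection -/

open scoped MatrixOrder in
theorem trace_mul_nonneg {A B : Matrix V V ℝ} (hA : A.PosSemidef) (hB : B.PosSemidef) :
    0 ≤ (A * B).trace := by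
  classical
  obtain ⟨C, rfl⟩ := CStarAlgebra.nonneg_iff_eq_star_mul_self.1 hA.nonneg
  rw [Matrix.star_eq_conjTranspose, Matrix.mul_assoc, Matrix.trace_mul_comm]
  exact (hB.mul_mul_conjTranspose_same C).trace_nonneg

theorem trace_mul_le_trace_mul {A B C : Matrix V V ℝ} (hA : A.PosSemidef)
    (hBC : (C - B).PosSemidef) : (A * B).trace ≤ (A * C).trace := by
  have h := trace_mul_nonneg hA hBC
  rw [Matrix.mul_sub, Matrix.trace_sub] at h
  linarith

variable [DecidableEq V]

variable (V) in
/-- The orthogonal projection `I - N⁻¹ 𝟙 𝟙ᵀ` onto the vectors whose entries sum to zero. -/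
def centering : Matrix V V ℝ :=
  1 - Matrix.of fun _ _ => (1 / (Fintype.card V : ℝ))

theorem transpose_centering : (centering V)ᵀ = centering V := by
  ext i j
  simp [centering, Matrix.one_apply, eq_comm]

theorem centering_mulVec_apply (x : V → ℝ) (i : V) :
    (centering V *ᵥ x) i = x i - (∑ j, x j) / Fintype.card V := by
  rw [centering, Matrix.sub_mulVec, Matrix.one_mulVec, Pi.sub_apply]
  simp [Matrix.mulVec, dotProduct, ← Finset.mul_sum, div_eq_inv_mul]

theorem mul_centering_of_mulVec_one {M : Matrix V V ℝ} (h : M *ᵥ 1 = 0) :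
    M * centering V = M := by
  have h' (i : V) : ∑ j, M i j = 0 := by simpa [Matrix.mulVec, dotProduct] using congrFun h i
  rw [centering, Matrix.mul_sub, Matrix.mul_one, sub_eq_self]
  ext i j
  simp [Matrix.mul_apply, ← Finset.sum_mul, h']

theorem centering_mul_of_mulVec_one {M : Matrix V V ℝ} (hM : Mᵀ = M) (h : M *ᵥ 1 = 0) :
    centering V * M = M := by
  have := congrArg Matrix.transpose (mul_centering_of_mulVec_one h)
  rwa [Matrix.transpose_mul, hM, transpose_centering] at this

theorem centering_mulVec_one [Nonempty V] : centering V *ᵥ 1 = 0 := by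
  ext i
  simp [centering_mulVec_apply]

theorem centering_mul_centering [Nonempty V] : centering V * centering V = centering V :=
  mul_centering_of_mulVec_one centering_mulVec_one

theorem sqDeviation_eq [Nonempty V] (x : V → ℝ) :
    sqDeviation x = x ⬝ᵥ centering V *ᵥ x := by
  rw [← centering_mul_centering, ← Matrix.mulVec_mulVec, Matrix.dotProduct_mulVec,
    ← Matrix.mulVec_transpose, transpose_centering]
  simp [sqDeviation, dotProduct, centering_mulVec_apply, sq]

theorem posSemidef_centering [Nonempty V] : (centering V).PosSemidef := by
  refine .of_dotProduct_mulVec_nonneg transpose_centering fun x => ?_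
  rw [star_trivial, ← sqDeviation_eq]
  exact Finset.sum_nonneg fun _ _ => sq_nonneg _

/-! ### The Laplacian of the active subgraph -/

variable (G : SimpleGraph V) [DecidableRel G.Adj]

theorem activeAdj_apply (γ : V → ℝ) (i j : V) :
    activeAdj G γ i j = γ i * G.adjMatrix ℝ i j * γ j := by
  rw [activeAdj, Matrix.mul_diagonal, Matrix.diagonal_mul]

theorem activeAdj_comm (γ : V → ℝ) (i j : V) : activeAdj G γ i j = activeAdj G γ j i := by
  simp only [activeAdj_apply, SimpleGraph.adjMatrix_apply, G.adj_comm i j]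
  ring

theorem transpose_activeLap (γ : V → ℝ) : (activeLap G γ)ᵀ = activeLap G γ := by
  rw [activeLap, Matrix.transpose_sub, Matrix.diagonal_transpose]
  congr 1
  ext i j
  exact activeAdj_comm G γ j i

theorem activeLap_mulVec_one (γ : V → ℝ) : activeLap G γ *ᵥ 1 = 0 := by
  ext i
  simp [activeLap, Matrix.sub_mulVec, Matrix.mulVec_diagonal]
  simp [Matrix.mulVec, dotProduct]

theorem activeLap_one : activeLap G 1 = G.lapMatrix ℝ := by
  ext i j
  simp [activeLap, activeAdj_apply, SimpleGraph.lapMatrix, SimpleGraph.degMatrix,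
    Matrix.diagonal_apply, SimpleGraph.degree_eq_sum_if_adj, SimpleGraph.adjMatrix_apply]

theorem transpose_lapMatrix : (G.lapMatrix ℝ)ᵀ = G.lapMatrix ℝ :=
  G.isSymm_lapMatrix ℝ

theorem lapMatrix_mulVec_one : G.lapMatrix ℝ *ᵥ 1 = 0 :=
  G.lapMatrix_mulVec_const_eq_zero

theorem dotProduct_activeLap_mulVec (γ x : V → ℝ) :
    x ⬝ᵥ activeLap G γ *ᵥ x = (∑ i, ∑ j, activeAdj G γ i j * (x i - x j) ^ 2) / 2 := by
  have h1 : x ⬝ᵥ activeLap G γ *ᵥ x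
      = (∑ i, ∑ j, activeAdj G γ i j * x i ^ 2) - ∑ i, ∑ j, activeAdj G γ i j * (x i * x j) := by
    rw [activeLap, Matrix.sub_mulVec, dotProduct_sub]
    simp only [dotProduct, Matrix.mulVec_diagonal]
    congr 1
    · refine Finset.sum_congr rfl fun i _ => ?_
      rw [Finset.sum_mul, Finset.mul_sum]
      exact Finset.sum_congr rfl fun j _ => by ring
    · refine Finset.sum_congr rfl fun i _ => ?_
      rw [Matrix.mulVec, dotProduct, Finset.mul_sum]
      exact Finset.sum_congr rfl fun j _ => by ring
  have h2 : ∑ i, ∑ j, activeAdj G γ i j * x j ^ 2 = ∑ i, ∑ j, activeAdj G γ i j * x i ^ 2 := by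
    rw [Finset.sum_comm]
    exact Finset.sum_congr rfl fun i _ => Finset.sum_congr rfl fun j _ => by
      rw [activeAdj_comm]
  have h3 : ∑ i, ∑ j, activeAdj G γ i j * (x i - x j) ^ 2
      = (∑ i, ∑ j, activeAdj G γ i j * x i ^ 2) + (∑ i, ∑ j, activeAdj G γ i j * x j ^ 2)
        - 2 * ∑ i, ∑ j, activeAdj G γ i j * (x i * x j) := by
    simp only [Finset.mul_sum, ← Finset.sum_add_distrib, ← Finset.sum_sub_distrib]
    exact Finset.sum_congr rfl fun i _ => Finset.sum_congr rfl fun j _ => by ring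
  rw [h1, h3, h2]
  ring

variable {γ : V → ℝ}

theorem posSemidef_activeLap (h0 : ∀ i, 0 ≤ γ i) : (activeLap G γ).PosSemidef := by
  refine .of_dotProduct_mulVec_nonneg (transpose_activeLap G γ) fun x => ?_
  rw [star_trivial, dotProduct_activeLap_mulVec]
  refine div_nonneg (Finset.sum_nonneg fun i _ => Finset.sum_nonneg fun j _ => ?_) zero_le_two
  rw [activeAdj_apply, SimpleGraph.adjMatrix_apply]
  have := h0 i
  have := h0 j
  positivity

/-- Deactivating nodes only removes edges, so it can only decrease the Laplacian. -/
theorem posSemidef_lapMatrix_sub_activeLap (h0 : ∀ i, 0 ≤ γ i) (h1 : ∀ i, γ i ≤ 1) :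
    (G.lapMatrix ℝ - activeLap G γ).PosSemidef := by
  rw [← activeLap_one]
  refine .of_dotProduct_mulVec_nonneg ?_ fun x => ?_
  · rw [Matrix.IsHermitian, Matrix.conjTranspose_eq_transpose_of_trivial, Matrix.transpose_sub,
      transpose_activeLap, transpose_activeLap]
  rw [star_trivial, Matrix.sub_mulVec, dotProduct_sub, dotProduct_activeLap_mulVec,
    dotProduct_activeLap_mulVec, sub_nonneg]
  gcongr with i _ j _
  simp only [activeAdj_apply, SimpleGraph.adjMatrix_apply, Pi.one_apply]
  split_ifs
  · nlinarith [h0 i, h1 i, h0 j, h1 j]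
  · simp

/-- `λ_max(L̄) ≤ 2 d_max`, as an inequality of quadratic forms. -/
theorem posSemidef_smul_one_sub_lapMatrix :
    ((2 * G.maxDegree : ℝ) • (1 : Matrix V V ℝ) - G.lapMatrix ℝ).PosSemidef := by
  refine .of_dotProduct_mulVec_nonneg ?_ fun x => ?_
  · rw [Matrix.IsHermitian, Matrix.conjTranspose_eq_transpose_of_trivial, Matrix.transpose_sub,
      transpose_lapMatrix, Matrix.transpose_smul, Matrix.transpose_one]
  rw [star_trivial, Matrix.sub_mulVec, dotProduct_sub, Matrix.smul_mulVec, Matrix.one_mulVec,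
    sub_nonneg, ← activeLap_one, dotProduct_activeLap_mulVec]
  have hdeg (i : V) : ∑ j, activeAdj G 1 i j = G.degree i := by
    simp [activeAdj_apply, SimpleGraph.degree_eq_sum_if_adj, SimpleGraph.adjMatrix_apply]
  have hle : ∑ i, ∑ j, activeAdj G 1 i j * (x i - x j) ^ 2
      ≤ ∑ i, ∑ j, (activeAdj G 1 i j * (2 * x i ^ 2) + activeAdj G 1 j i * (2 * x j ^ 2)) := by
    refine Finset.sum_le_sum fun i _ => Finset.sum_le_sum fun j _ => ?_
    rw [activeAdj_comm G 1 j i, ← mul_add]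
    refine mul_le_mul_of_nonneg_left (by nlinarith [sq_nonneg (x i + x j)]) ?_
    simp only [activeAdj_apply, SimpleGraph.adjMatrix_apply, Pi.one_apply]
    positivity
  have hsum : ∑ i, ∑ j, (activeAdj G 1 i j * (2 * x i ^ 2) + activeAdj G 1 j i * (2 * x j ^ 2))
      = 4 * ∑ i, (G.degree i : ℝ) * x i ^ 2 := by
    simp only [Finset.sum_add_distrib]
    rw [Finset.sum_comm (f := fun i j => activeAdj G 1 j i * (2 * x j ^ 2))]
    simp only [← Finset.sum_mul, hdeg, Finset.mul_sum, ← Finset.sum_add_distrib]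
    exact Finset.sum_congr rfl fun i _ => by ring
  have hmax : ∑ i, (G.degree i : ℝ) * x i ^ 2 ≤ G.maxDegree * (x ⬝ᵥ x) := by
    simp only [dotProduct, Finset.mul_sum, ← sq]
    gcongr with i _
    exact G.degree_le_maxDegree i
  rw [dotProduct_smul, smul_eq_mul]
  linarith

theorem posSemidef_smul_centering_sub_lapMatrix [Nonempty V] :
    ((2 * G.maxDegree : ℝ) • centering V - G.lapMatrix ℝ).PosSemidef := by
  have h := (posSemidef_smul_one_sub_lapMatrix G).conjTranspose_mul_mul_same (centering V)
  rwa [Matrix.conjTranspose_eq_transpose_of_trivial, transpose_centering, Matrix.mul_sub,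
    Matrix.sub_mul, Matrix.mul_smul, Matrix.smul_mul, Matrix.mul_one, centering_mul_centering,
    centering_mul_of_mulVec_one (transpose_lapMatrix G) (lapMatrix_mulVec_one G),
    mul_centering_of_mulVec_one (lapMatrix_mulVec_one G)] at h

end

section

variable {V : Type*} [Fintype V] [DecidableEq V] (G : SimpleGraph V) [DecidableRel G.Adj]

/-! ### The pseudo-inverse of the Laplacian and the average effective resistance -/

/-- The smallest Laplacian eigenvalue is `0`, so leaving it out of the resistance sum agrees with
inverting it by the convention `0⁻¹ = 0`. -/
theorem lapEigenvalue_eq_zero [Nonempty V] (i : Fin (Fintype.card V)) (hi : i.val = 0) :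
    lapEigenvalue G i = 0 := by
  set hL := G.isHermitian_lapMatrix ℝ
  have hnn (j : V) : 0 ≤ hL.eigenvalues j := (G.posSemidef_lapMatrix ℝ).eigenvalues_nonneg j
  have hdet : (G.lapMatrix ℝ).det = 0 :=
    Matrix.exists_mulVec_eq_zero_iff.1 ⟨1, one_ne_zero, lapMatrix_mulVec_one G⟩
  rw [hL.det_eq_prod_eigenvalues, Finset.prod_eq_zero_iff] at hdet
  obtain ⟨j, -, hj⟩ := hdet
  set e : Fin (Fintype.card V) ≃ V := Fintype.equivOfCardEq (Fintype.card_fin _)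
  refine le_antisymm ?_ ?_
  · have hj' : hL.eigenvalues₀ (e.symm j) = 0 := by exact_mod_cast hj
    rw [← hj']
    refine hL.eigenvalues₀_antitone ?_
    rw [Fin.le_def, Fin.val_rev, hi]
    omega
  · have := hnn (e (Fin.rev i))
    rwa [Matrix.IsHermitian.eigenvalues, Equiv.symm_apply_apply] at this

theorem sum_inv_eigenvalues [Nonempty V] :
    ∑ i, ((G.isHermitian_lapMatrix ℝ).eigenvalues i)⁻¹ = Fintype.card V * avgResistance G := by
  have hN : (Fintype.card V : ℝ) ≠ 0 := by simp
  rw [avgResistance, ← mul_assoc, mul_one_div_cancel hN, one_mul, Finset.sum_filter]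
  set e : Fin (Fintype.card V) ≃ V := Fintype.equivOfCardEq (Fintype.card_fin _)
  rw [← (Fin.revPerm.trans e).sum_comp]
  refine Finset.sum_congr rfl fun i _ => ?_
  have h : (G.isHermitian_lapMatrix ℝ).eigenvalues (Fin.revPerm.trans e i) = lapEigenvalue G i := by
    rw [Matrix.IsHermitian.eigenvalues, Equiv.trans_apply, Equiv.symm_apply_apply]
    rfl
  rw [h]
  split_ifs with hi
  · rw [one_div]
  · rw [lapEigenvalue_eq_zero G i (by omega), inv_zero]

theorem avgResistance_nonneg [Nonempty V] : 0 ≤ avgResistance G := by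
  have h : (0 : ℝ) ≤ Fintype.card V * avgResistance G := by
    rw [← sum_inv_eigenvalues]
    exact Finset.sum_nonneg fun i _ =>
      inv_nonneg.2 ((G.posSemidef_lapMatrix ℝ).eigenvalues_nonneg i)
  exact nonneg_of_mul_nonneg_right h (by simp [Fintype.card_pos])

/-- The Moore–Penrose inverse of the graph Laplacian. In an eigenbasis it is diagonal with entries
`λ⁻¹`, where the convention `0⁻¹ = 0` takes care of the kernel. -/
def lapPinv : Matrix V V ℝ :=
  Unitary.conjStarAlgAut ℝ _ (G.isHermitian_lapMatrix ℝ).eigenvectorUnitary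
    (Matrix.diagonal fun i => ((G.isHermitian_lapMatrix ℝ).eigenvalues i)⁻¹)

theorem posSemidef_conj_diagonal (U : Matrix.unitaryGroup V ℝ) {d : V → ℝ} (hd : 0 ≤ d) :
    (Unitary.conjStarAlgAut ℝ (Matrix V V ℝ) U (Matrix.diagonal d)).PosSemidef := by
  rw [Unitary.conjStarAlgAut_apply]
  exact (Matrix.PosSemidef.diagonal hd).mul_mul_conjTranspose_same _

theorem posSemidef_lapPinv : (lapPinv G).PosSemidef :=
  posSemidef_conj_diagonal _ fun i =>
    inv_nonneg.2 ((G.posSemidef_lapMatrix ℝ).eigenvalues_nonneg i)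

theorem transpose_lapPinv : (lapPinv G)ᵀ = lapPinv G :=
  (posSemidef_lapPinv G).isHermitian

theorem trace_lapPinv [Nonempty V] :
    (lapPinv G).trace = Fintype.card V * avgResistance G := by
  rw [lapPinv, Unitary.conjStarAlgAut_apply, Matrix.trace_mul_cycle]
  simp [sum_inv_eigenvalues]

theorem lapMatrix_eq_conj : G.lapMatrix ℝ =
    Unitary.conjStarAlgAut ℝ _ (G.isHermitian_lapMatrix ℝ).eigenvectorUnitary
      (Matrix.diagonal (G.isHermitian_lapMatrix ℝ).eigenvalues) := by
  conv_lhs => rw [(G.isHermitian_lapMatrix ℝ).spectral_theorem]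
  rfl

theorem lapMatrix_mul_lapPinv_eq_conj : G.lapMatrix ℝ * lapPinv G =
    Unitary.conjStarAlgAut ℝ _ (G.isHermitian_lapMatrix ℝ).eigenvectorUnitary
      (Matrix.diagonal fun i => (G.isHermitian_lapMatrix ℝ).eigenvalues i *
        ((G.isHermitian_lapMatrix ℝ).eigenvalues i)⁻¹) := by
  conv_lhs => rw [lapMatrix_eq_conj, lapPinv, ← map_mul, Matrix.diagonal_mul_diagonal]

theorem lapPinv_mul_lapMatrix_comm :
    lapPinv G * G.lapMatrix ℝ = G.lapMatrix ℝ * lapPinv G := by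
  rw [lapMatrix_mul_lapPinv_eq_conj]
  conv_lhs => rw [lapMatrix_eq_conj, lapPinv, ← map_mul, Matrix.diagonal_mul_diagonal]
  simp_rw [mul_comm]

theorem lapMatrix_mul_lapPinv_mul_lapMatrix :
    G.lapMatrix ℝ * lapPinv G * G.lapMatrix ℝ = G.lapMatrix ℝ := by
  rw [lapMatrix_mul_lapPinv_eq_conj]
  conv_lhs => enter [2]; rw [lapMatrix_eq_conj]
  conv_rhs => rw [lapMatrix_eq_conj]
  rw [← map_mul, Matrix.diagonal_mul_diagonal]
  simp

variable {G}

/-- On a connected graph only constants are harmonic, so `L̄ L̄⁺` is the centering projection. -/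
theorem lapMatrix_mul_lapPinv (hG : G.Connected) : G.lapMatrix ℝ * lapPinv G = centering V := by
  have := hG.nonempty
  -- `F` is the projection onto the kernel of the Laplacian: a symmetric matrix with constant
  -- columns and row sums `1`.
  set F : Matrix V V ℝ := 1 - G.lapMatrix ℝ * lapPinv G with hF
  have hLF : G.lapMatrix ℝ * F = 0 := by
    rw [hF, Matrix.mul_sub, Matrix.mul_one, ← lapPinv_mul_lapMatrix_comm, ← Matrix.mul_assoc,
      lapMatrix_mul_lapPinv_mul_lapMatrix, sub_self]
  have hsymm : Fᵀ = F := by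
    rw [hF, Matrix.transpose_sub, Matrix.transpose_one, Matrix.transpose_mul, transpose_lapPinv,
      transpose_lapMatrix, lapPinv_mul_lapMatrix_comm]
  have hcol (i i' j : V) : F i j = F i' j := by
    have h : G.lapMatrix ℝ *ᵥ (fun i => F i j) = 0 := by
      ext i
      exact congrFun (congrFun hLF i) j
    exact G.lapMatrix_mulVec_eq_zero_iff_forall_reachable.1 h i i' (hG.preconnected i i')
  have hconst (i j i' j' : V) : F i j = F i' j' := by
    rw [hcol i j' j, ← hsymm, Matrix.transpose_apply, hcol j i' j', hsymm]
  have hF1 : F *ᵥ 1 = 1 := by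
    rw [hF, ← lapPinv_mul_lapMatrix_comm, Matrix.sub_mulVec, ← Matrix.mulVec_mulVec,
      lapMatrix_mulVec_one, Matrix.mulVec_zero, sub_zero, Matrix.one_mulVec]
  have hval (i j : V) : F i j = 1 / Fintype.card V := by
    have h : ∑ j', F i j' = 1 := by simpa [Matrix.mulVec, dotProduct] using congrFun hF1 i
    rw [Finset.sum_congr rfl fun j' _ => hconst i j' i j, Finset.sum_const, Finset.card_univ,
      nsmul_eq_mul] at h
    rw [eq_div_iff (by simp), mul_comm, h]
  have : F = Matrix.of fun _ _ => 1 / (Fintype.card V : ℝ) := by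
    ext i j
    exact hval i j
  rw [centering, ← this, hF, sub_sub_cancel]

theorem lapPinv_mul_lapMatrix (hG : G.Connected) : lapPinv G * G.lapMatrix ℝ = centering V := by
  rw [lapPinv_mul_lapMatrix_comm, lapMatrix_mul_lapPinv hG]

/-- The trace of `L̄⁺` is at least its largest eigenvalue. -/
theorem posSemidef_smul_centering_sub_lapPinv (hG : G.Connected) :
    ((lapPinv G).trace • centering V - lapPinv G).PosSemidef := by
  have := hG.nonempty
  set l := (G.isHermitian_lapMatrix ℝ).eigenvalues with hl
  have hnn (i : V) : 0 ≤ (l i)⁻¹ :=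
    inv_nonneg.2 ((G.posSemidef_lapMatrix ℝ).eigenvalues_nonneg i)
  have h : (lapPinv G).trace • centering V - lapPinv G =
      Unitary.conjStarAlgAut ℝ _ (G.isHermitian_lapMatrix ℝ).eigenvectorUnitary
        (Matrix.diagonal fun i => (∑ j, (l j)⁻¹) * (l i * (l i)⁻¹) - (l i)⁻¹) := by
    rw [trace_lapPinv, ← sum_inv_eigenvalues, ← lapMatrix_mul_lapPinv hG,
      lapMatrix_mul_lapPinv_eq_conj, lapPinv, ← map_smul, ← map_sub, ← Matrix.diagonal_smul,
      Matrix.diagonal_sub]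
    rfl
  rw [h]
  refine posSemidef_conj_diagonal _ fun i => ?_
  have hle : (l i)⁻¹ ≤ ∑ j, (l j)⁻¹ := Finset.single_le_sum (fun j _ => hnn j) (Finset.mem_univ i)
  by_cases h0 : l i = 0
  · simp [h0]
  · simpa [h0] using hle

/-- If `0 ≤ L ≤ L̄` then `L L̄⁺ L ≤ L`; this is what bounds the second-order term of the
Lyapunov function `x ↦ xᵀ L̄⁺ x` by the first-order one. -/
theorem posSemidef_sub_mul_lapPinv_mul (hG : G.Connected) {M : Matrix V V ℝ} (hM : M.PosSemidef)
    (hle : (G.lapMatrix ℝ - M).PosSemidef) (h1 : M *ᵥ 1 = 0) :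
    (M - M * lapPinv G * M).PosSemidef := by
  have hMt : Mᵀ = M := hM.isHermitian
  -- With `Q = L̄⁺`: `M - M Q M = (1 - Q M)ᵀ M (1 - Q M) + (Q M)ᵀ (L̄ - M) (Q M)`.
  have h2 := hM.conjTranspose_mul_mul_same (1 - lapPinv G * M)
  have h3 := hle.conjTranspose_mul_mul_same (lapPinv G * M)
  have hQQ : M * lapPinv G * G.lapMatrix ℝ * lapPinv G * M = M * lapPinv G * M := by
    rw [Matrix.mul_assoc M, lapPinv_mul_lapMatrix hG, mul_centering_of_mulVec_one h1]
  have h4 := h2.add h3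
  simp only [Matrix.conjTranspose_eq_transpose_of_trivial, Matrix.transpose_sub,
    Matrix.transpose_mul, Matrix.transpose_one, transpose_lapPinv, hMt] at h4
  convert h4 using 1
  rw [← sub_eq_zero]
  have : M - M * lapPinv G * M - ((1 - M * lapPinv G) * M * (1 - lapPinv G * M) +
      M * lapPinv G * (G.lapMatrix ℝ - M) * (lapPinv G * M))
      = M * lapPinv G * M - M * lapPinv G * G.lapMatrix ℝ * lapPinv G * M := by
    noncomm_ring
  rw [this, hQQ, sub_self]

end

section

/-! ### The mean action of one random step on second-moment matrices -/

/-- A continuous function of countably many variables with values in `[0, 1]` is bounded, the cube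
being compact. -/
theorem integrable_comp_of_continuous {ι Ω : Type*} [Countable ι] [MeasurableSpace Ω]
    {μ : Measure Ω} [IsFiniteMeasure μ] {g : Ω → ι → ℝ} (hg : ∀ i, AEMeasurable (fun ω => g ω i) μ)
    (h01 : ∀ i, ∀ᵐ ω ∂μ, g ω i ∈ Set.Icc (0 : ℝ) 1) {f : (ι → ℝ) → ℝ} (hf : Continuous f) :
    Integrable (fun ω => f (g ω)) μ := by
  have hK : IsCompact (Set.univ.pi fun _ : ι => Set.Icc (0 : ℝ) 1) :=
    isCompact_univ_pi fun _ => isCompact_Icc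
  obtain ⟨C, hC⟩ := hK.exists_bound_of_continuousOn hf.continuousOn
  refine .of_bound (hf.measurable.comp_aemeasurable
    (aemeasurable_pi_lambda _ hg)).aestronglyMeasurable C ?_
  filter_upwards [ae_all_iff.2 h01] with ω hω
  exact hC _ fun i _ => hω i

variable {V : Type*} [Fintype V]

variable (V) in
/-- The joint law of the activations of all nodes at one time. -/
def activationLaw (p : unitInterval) : Measure (V → ℝ) :=
  Measure.pi fun _ => bernoulliMeasure (1 : ℝ) 0 p

instance (p : unitInterval) : IsProbabilityMeasure (activationLaw V p) := by
  unfold activationLaw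
  infer_instance

theorem ae_bernoulliMeasure_mem_Icc (p : unitInterval) :
    ∀ᵐ x ∂bernoulliMeasure (1 : ℝ) 0 p, x ∈ Set.Icc (0 : ℝ) 1 := by
  rw [ae_iff, show {x : ℝ | ¬x ∈ Set.Icc (0 : ℝ) 1} = (Set.Icc 0 1)ᶜ from rfl,
    bernoulliMeasure_apply_of_notMem_of_notMem p measurableSet_Icc.compl (by simp) (by simp)]

theorem ae_activationLaw_mem_Icc (p : unitInterval) (i : V) :
    ∀ᵐ g ∂activationLaw V p, g i ∈ Set.Icc (0 : ℝ) 1 :=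
  (measurePreserving_eval (fun _ : V => bernoulliMeasure (1 : ℝ) 0 p) i).quasiMeasurePreserving.ae
    (ae_bernoulliMeasure_mem_Icc p)

theorem integrable_activationLaw (p : unitInterval) {f : (V → ℝ) → ℝ} (hf : Continuous f) :
    Integrable f (activationLaw V p) :=
  integrable_comp_of_continuous (g := id) (fun i => (measurable_pi_apply i).aemeasurable)
    (ae_activationLaw_mem_Icc p) hf

theorem integral_activationLaw_mul (p : unitInterval) {i j : V} (hij : i ≠ j) :
    ∫ g, g i * g j ∂activationLaw V p = (p : ℝ) ^ 2 := by
  have hint (k : V) : ∫ g, g k ∂activationLaw V p = p := by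
    have h := (measurePreserving_eval (fun _ : V => bernoulliMeasure (1 : ℝ) 0 p) k).hasLaw
      |>.integral_eq
    rw [activationLaw]
    refine h.trans ?_
    simp [integral_bernoulliMeasure]
  have hind : IndepFun (fun g : V → ℝ => g i) (fun g => g j) (activationLaw V p) :=
    (iIndepFun_pi (μ := fun _ : V => bernoulliMeasure (1 : ℝ) 0 p) (X := fun _ => id)
      fun _ => aemeasurable_id).indepFun hij
  rw [hind.integral_fun_mul_eq_mul_integral (measurable_pi_apply i).aestronglyMeasurable
    (measurable_pi_apply j).aestronglyMeasurable, hint, hint, sq]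

variable [DecidableEq V] (G : SimpleGraph V) [DecidableRel G.Adj]

@[fun_prop]
theorem continuous_activeLap : Continuous (activeLap G) := by
  unfold activeLap activeAdj
  fun_prop

@[fun_prop]
theorem continuous_ridl (ε : ℝ) : Continuous (ridl G ε) := by
  unfold ridl
  fun_prop

theorem transpose_ridl (ε : ℝ) (g : V → ℝ) : (ridl G ε g)ᵀ = ridl G ε g := by
  rw [ridl, Matrix.transpose_sub, Matrix.transpose_smul, transpose_activeLap, Matrix.transpose_one]

/-- `E[L] = p² L̄`: an edge is present when both of its endpoints are active. -/
theorem integral_trace_mul_activeLap (p : unitInterval) (X : Matrix V V ℝ) :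
    ∫ g, (X * activeLap G g).trace ∂activationLaw V p
      = (p : ℝ) ^ 2 * (X * G.lapMatrix ℝ).trace := by
  have hint (i j : V) : Integrable (fun g => activeAdj G g i j) (activationLaw V p) :=
    integrable_activationLaw p (by simp only [activeAdj_apply]; fun_prop)
  have hadj (i j : V) : ∫ g, activeAdj G g i j ∂activationLaw V p = p ^ 2 * activeAdj G 1 i j := by
    simp only [activeAdj_apply, SimpleGraph.adjMatrix_apply, Pi.one_apply]
    split_ifs with h
    · simp [integral_activationLaw_mul p h.ne]
    · simp
  have hlap (i j : V) : ∫ g, activeLap G g i j ∂activationLaw V p = p ^ 2 * activeLap G 1 i j := by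
    simp only [activeLap, Matrix.sub_apply, Matrix.diagonal_apply]
    split_ifs with h
    · rw [integral_sub (integrable_finsetSum _ fun k _ => hint i k) (hint i j),
        integral_finsetSum _ fun k _ => hint i k]
      simp only [hadj, mul_sub, Finset.mul_sum]
    · simp [integral_neg, hadj]
  rw [← activeLap_one]
  simp only [Matrix.trace, Matrix.diag_apply, Matrix.mul_apply]
  rw [integral_finsetSum _ fun i _ => integrable_activationLaw p (by fun_prop), Finset.mul_sum]
  refine Finset.sum_congr rfl fun i _ => ?_
  rw [integral_finsetSum _ fun j _ => integrable_activationLaw p (by fun_prop), Finset.mul_sum]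
  refine Finset.sum_congr rfl fun j _ => ?_
  rw [integral_const_mul, hlap]
  ring

/-- The linear map `X ↦ E[P X P]` on matrices, where `P` is the random matrix of one step. -/
def meanConj (ε : ℝ) (p : unitInterval) : Module.End ℝ (Matrix V V ℝ) where
  toFun X := Matrix.of fun i j => ∫ g, (ridl G ε g * X * ridl G ε g) i j ∂activationLaw V p
  map_add' X Y := by
    ext i j
    simp only [Matrix.mul_add, Matrix.add_mul, Matrix.add_apply, Matrix.of_apply]
    exact integral_add (integrable_activationLaw p (by fun_prop))
      (integrable_activationLaw p (by fun_prop))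
  map_smul' c X := by
    ext i j
    simp [integral_const_mul]

theorem meanConj_apply (ε : ℝ) (p : unitInterval) (X : Matrix V V ℝ) (i j : V) :
    meanConj G ε p X i j = ∫ g, (ridl G ε g * X * ridl G ε g) i j ∂activationLaw V p :=
  rfl

theorem trace_mul_meanConj (ε : ℝ) (p : unitInterval) (A X : Matrix V V ℝ) :
    (A * meanConj G ε p X).trace
      = ∫ g, (A * (ridl G ε g * X * ridl G ε g)).trace ∂activationLaw V p := by
  simp only [Matrix.trace, Matrix.diag_apply, Matrix.mul_apply (M := A)]
  rw [integral_finsetSum _ fun i _ => integrable_activationLaw p (by fun_prop)]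
  refine Finset.sum_congr rfl fun i _ => ?_
  rw [integral_finsetSum _ fun j _ => integrable_activationLaw p (by fun_prop)]
  refine Finset.sum_congr rfl fun j _ => ?_
  rw [integral_const_mul, meanConj_apply]

theorem posSemidef_meanConj (ε : ℝ) (p : unitInterval) {X : Matrix V V ℝ} (hX : X.PosSemidef) :
    (meanConj G ε p X).PosSemidef := by
  have hPXP (g : V → ℝ) : (ridl G ε g * X * ridl G ε g).PosSemidef := by
    have h := hX.conjTranspose_mul_mul_same (ridl G ε g)
    rwa [Matrix.conjTranspose_eq_transpose_of_trivial, transpose_ridl] at h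
  refine .of_dotProduct_mulVec_nonneg ?_ fun x => ?_
  · ext i j
    rw [Matrix.conjTranspose_apply, star_trivial, meanConj_apply, meanConj_apply]
    exact integral_congr_ae (.of_forall fun g => (hPXP g).isHermitian.apply i j)
  · have h (Y : Matrix V V ℝ) : x ⬝ᵥ Y *ᵥ x = (Matrix.vecMulVec x x * Y).trace := by
      rw [Matrix.vecMulVec_mul, Matrix.trace_vecMulVec, Matrix.dotProduct_mulVec, dotProduct_comm]
    rw [star_trivial, h, trace_mul_meanConj]
    refine integral_nonneg fun g => ?_
    rw [Pi.zero_apply, ← h]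
    exact (hPXP g).dotProduct_mulVec_nonneg x

theorem posSemidef_meanConj_pow (ε : ℝ) (p : unitInterval) {X : Matrix V V ℝ} (hX : X.PosSemidef)
    (t : ℕ) : ((meanConj G ε p ^ t) X).PosSemidef := by
  induction t with
  | zero => simpa using hX
  | succ t ih =>
    rw [pow_succ', Module.End.mul_apply]
    exact posSemidef_meanConj G ε p ih

variable {G}

/-- The mean change of the Lyapunov function `X ↦ tr(L̄⁺ X)` in one step. -/
theorem trace_lapPinv_mul_meanConj (hG : G.Connected) (ε : ℝ) (p : unitInterval)
    (X : Matrix V V ℝ) :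
    (lapPinv G * meanConj G ε p X).trace
      = (lapPinv G * X).trace - 2 * ε * p ^ 2 * (centering V * X).trace
        + ε ^ 2 * ∫ g, (X * (activeLap G g * lapPinv G * activeLap G g)).trace
          ∂activationLaw V p := by
  set Q := lapPinv G with hQ
  have hexp (g : V → ℝ) : (Q * (ridl G ε g * X * ridl G ε g)).trace
      = (Q * X).trace - ε * ((X * Q * activeLap G g).trace + (Q * X * activeLap G g).trace)
        + ε ^ 2 * (X * (activeLap G g * Q * activeLap G g)).trace := by
    have h1 : (Q * (ridl G ε g * X * ridl G ε g)).trace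
        = (ridl G ε g * Q * ridl G ε g * X).trace := by
      rw [← Matrix.mul_assoc, Matrix.trace_mul_comm]
      simp only [Matrix.mul_assoc]
    have h2 : ridl G ε g * Q * ridl G ε g * X = Q * X
        - ε • (Q * activeLap G g * X + activeLap G g * (Q * X))
        + ε ^ 2 • (activeLap G g * Q * activeLap G g * X) := by
      simp only [ridl, Matrix.sub_mul, Matrix.mul_sub, Matrix.one_mul, Matrix.mul_one,
        Matrix.smul_mul, Matrix.mul_smul, Matrix.mul_assoc]
      module
    rw [h1, h2, Matrix.trace_add, Matrix.trace_sub, Matrix.trace_smul, Matrix.trace_smul,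
      Matrix.trace_add, smul_eq_mul, smul_eq_mul, Matrix.trace_mul_cycle Q,
      Matrix.trace_mul_comm (activeLap G g) (Q * X),
      Matrix.trace_mul_comm (activeLap G g * Q * activeLap G g) X]
  have hcyc1 : (X * Q * G.lapMatrix ℝ).trace = (centering V * X).trace := by
    rw [Matrix.mul_assoc, lapPinv_mul_lapMatrix hG, Matrix.trace_mul_comm]
  have hcyc2 : (Q * X * G.lapMatrix ℝ).trace = (centering V * X).trace := by
    rw [Matrix.trace_mul_cycle, lapMatrix_mul_lapPinv hG]
  rw [trace_mul_meanConj]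
  simp only [hexp]
  rw [integral_add (integrable_activationLaw p (by fun_prop))
      (integrable_activationLaw p (by fun_prop)),
    integral_sub (integrable_activationLaw p (by fun_prop))
      (integrable_activationLaw p (by fun_prop)), integral_const_mul, integral_const_mul,
    integral_add (integrable_activationLaw p (by fun_prop))
      (integrable_activationLaw p (by fun_prop)), integral_trace_mul_activeLap,
    integral_trace_mul_activeLap, hcyc1, hcyc2]
  simp
  ring

theorem le_trace_lapPinv_mul_meanConj (hG : G.Connected) (ε : ℝ) (p : unitInterval)
    {X : Matrix V V ℝ} (hX : X.PosSemidef) :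
    (lapPinv G * X).trace - 2 * ε * p ^ 2 * (centering V * X).trace
      ≤ (lapPinv G * meanConj G ε p X).trace := by
  rw [trace_lapPinv_mul_meanConj hG, le_add_iff_nonneg_right]
  refine mul_nonneg (sq_nonneg ε) (integral_nonneg fun g => trace_mul_nonneg hX ?_)
  have h := (posSemidef_lapPinv G).conjTranspose_mul_mul_same (activeLap G g)
  rwa [Matrix.conjTranspose_eq_transpose_of_trivial, transpose_activeLap] at h

/-- The Lyapunov function `xᵀ L̄⁺ x` decreases in mean, by a multiple of the squared deviation. -/
theorem trace_lapPinv_mul_meanConj_le (hG : G.Connected) (ε : ℝ) (p : unitInterval)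
    {X : Matrix V V ℝ} (hX : X.PosSemidef) :
    (lapPinv G * meanConj G ε p X).trace
      ≤ (lapPinv G * X).trace
        - 2 * ε * p ^ 2 * (1 - ε * G.maxDegree) * (centering V * X).trace := by
  have := hG.nonempty
  have h1 : ∫ g, (X * (activeLap G g * lapPinv G * activeLap G g)).trace ∂activationLaw V p
      ≤ ∫ g, (X * activeLap G g).trace ∂activationLaw V p := by
    refine integral_mono_ae (integrable_activationLaw p (by fun_prop))
      (integrable_activationLaw p (by fun_prop)) ?_
    filter_upwards [ae_all_iff.2 (ae_activationLaw_mem_Icc (V := V) p)] with g hg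
    exact trace_mul_le_trace_mul hX <| posSemidef_sub_mul_lapPinv_mul hG
      (posSemidef_activeLap G fun i => (hg i).1)
      (posSemidef_lapMatrix_sub_activeLap G (fun i => (hg i).1) fun i => (hg i).2)
      (activeLap_mulVec_one G g)
  have h2 : (X * G.lapMatrix ℝ).trace ≤ 2 * G.maxDegree * (centering V * X).trace := by
    have h := trace_mul_le_trace_mul hX (posSemidef_smul_centering_sub_lapMatrix G)
    rwa [Matrix.mul_smul, Matrix.trace_smul, smul_eq_mul, Matrix.trace_mul_comm X (centering V)]
      at h
  rw [integral_trace_mul_activeLap] at h1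
  rw [trace_lapPinv_mul_meanConj hG]
  have h3 := h1.trans (mul_le_mul_of_nonneg_left h2 (sq_nonneg (p : ℝ)))
  have h4 := mul_le_mul_of_nonneg_left h3 (sq_nonneg ε)
  linarith

end

section

/-! ### Convergence of the accumulated noise -/

/-- If `q` loses at least `δ a` and at most `β a` at each step and `0 ≤ q ≤ C a`, then `a` is
summable and its sum lies between `q 0 / β` and `q 0 / δ`. -/
theorem summable_of_lyapunov {a q : ℕ → ℝ} {β δ C : ℝ} (hδ : 0 < δ) (ha : ∀ t, 0 ≤ a t)
    (hq : ∀ t, 0 ≤ q t) (hqa : ∀ t, q t ≤ C * a t) (hlow : ∀ t, q t - β * a t ≤ q (t + 1))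
    (hupp : ∀ t, q (t + 1) ≤ q t - δ * a t) :
    Summable a ∧ q 0 ≤ β * ∑' t, a t ∧ δ * ∑' t, a t ≤ q 0 := by
  have hupp' (t : ℕ) : δ * ∑ s ∈ Finset.range t, a s ≤ q 0 - q t := by
    induction t with
    | zero => simp
    | succ t ih => rw [Finset.sum_range_succ]; linarith [hupp t]
  have hlow' (t : ℕ) : q 0 - q t ≤ β * ∑ s ∈ Finset.range t, a s := by
    induction t with
    | zero => simp
    | succ t ih => rw [Finset.sum_range_succ]; linarith [hlow t]
  have hsum : Summable a := by
    refine summable_of_sum_range_le (c := q 0 / δ) ha fun t => ?_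
    rw [le_div_iff₀' hδ]
    linarith [hupp' t, hq t]
  have hlim := hsum.hasSum.tendsto_sum_nat
  have hq0 : Tendsto q atTop (𝓝 0) := by
    refine squeeze_zero hq hqa ?_
    simpa using hsum.tendsto_atTop_zero.const_mul C
  refine ⟨hsum, ?_, ?_⟩
  · refine le_of_tendsto_of_tendsto' ?_ (hlim.const_mul β) hlow'
    simpa using hq0.const_sub (q 0)
  · exact le_of_tendsto' (hlim.const_mul δ) fun t => (hupp' t).trans (by linarith [hq t])

variable {V : Type*} [Fintype V] [DecidableEq V] {G : SimpleGraph V} [DecidableRel G.Adj]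

theorem lyapunov_meanConj_pow (hG : G.Connected) {ε : ℝ} (hε : 0 < ε)
    (hk : ε * G.maxDegree < 1) {p : unitInterval} (hp : 0 < (p : ℝ)) {X : Matrix V V ℝ}
    (hX : X.PosSemidef) :
    Summable (fun t => (centering V * (meanConj G ε p ^ t) X).trace) ∧
    (lapPinv G * X).trace
      ≤ 2 * ε * p ^ 2 * ∑' t, (centering V * (meanConj G ε p ^ t) X).trace ∧
    2 * ε * p ^ 2 * (1 - ε * G.maxDegree) * ∑' t, (centering V * (meanConj G ε p ^ t) X).trace
      ≤ (lapPinv G * X).trace := by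
  have := hG.nonempty
  have hpos := posSemidef_meanConj_pow G ε p hX
  have hk' : 0 < 1 - ε * G.maxDegree := by linarith
  refine summable_of_lyapunov
    (q := fun t => (lapPinv G * (meanConj G ε p ^ t) X).trace) (C := (lapPinv G).trace)
    (by positivity) (fun t => trace_mul_nonneg posSemidef_centering (hpos t))
    (fun t => trace_mul_nonneg (posSemidef_lapPinv G) (hpos t)) (fun t => ?_) (fun t => ?_)
    fun t => ?_
  · have h := trace_mul_le_trace_mul (hpos t) (posSemidef_smul_centering_sub_lapPinv hG)
    rwa [Matrix.mul_smul, Matrix.trace_smul, smul_eq_mul, Matrix.trace_mul_comm _ (centering V),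
      Matrix.trace_mul_comm _ (lapPinv G)] at h
  · simp only [pow_succ' (meanConj G ε p), Module.End.mul_apply]
    exact le_trace_lapPinv_mul_meanConj hG ε p (hpos t)
  · simp only [pow_succ' (meanConj G ε p), Module.End.mul_apply]
    exact trace_lapPinv_mul_meanConj_le hG ε p (hpos t)

/-! ### Second moments for a fixed activation sequence -/

variable (G) in
/-- The matrix `E[x(t) x(t)ᵀ]` when the activations are deterministic. -/
def stateMoment (ε σ : ℝ) (x₀ : V → ℝ) (g : ℕ → V → ℝ) : ℕ → Matrix V V ℝ
  | 0 => Matrix.vecMulVec x₀ x₀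
  | t + 1 => ridl G ε (g t) * stateMoment ε σ x₀ g t * ridl G ε (g t) + σ ^ 2 • 1

variable {Ω : Type*} [MeasurableSpace Ω] {μ : Measure Ω} [IsProbabilityMeasure μ]
  {n : ℕ → V → Ω → ℝ} {σ : ℝ}

omit [Fintype V] in
theorem IsWhiteNoise.integral_mul (hn : IsWhiteNoise μ σ n) (t : ℕ) (i : V) (s : ℕ) (j : V) :
    ∫ ω, n t i ω * n s j ω ∂μ = if (t, i) = (s, j) then σ ^ 2 else 0 := by
  have h : covariance (n t i) (n s j) μ = ∫ ω, n t i ω * n s j ω ∂μ := by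
    rw [covariance_eq_sub (hn.memLp t i) (hn.memLp s j), hn.mean, hn.mean, zero_mul, sub_zero]
    rfl
  rw [← h]
  split_ifs with heq
  · obtain ⟨rfl, rfl⟩ := Prod.mk.inj heq
    rw [covariance_self (hn.memLp t i).aemeasurable, hn.variance]
  · exact hn.uncorrelated t i s j heq

omit [MeasurableSpace Ω] in
theorem state_succ_apply (ε : ℝ) (γ : ℕ → V → Ω → ℝ) (x₀ : V → ℝ) (t : ℕ) (ω : Ω) (i : V) :
    state G ε γ n x₀ (t + 1) ω i
      = ∑ j, ridl G ε (fun i => γ t i ω) i j * state G ε γ n x₀ t ω j + n t i ω :=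
  rfl

variable (g : ℕ → V → ℝ) (ε : ℝ) (x₀ : V → ℝ)

theorem memLp_state (hn : IsWhiteNoise μ σ n) (t : ℕ) (i : V) :
    MemLp (fun ω => state G ε (fun t i _ => g t i) n x₀ t ω i) 2 μ := by
  induction t generalizing i with
  | zero => exact memLp_const _
  | succ t ih =>
    simp only [state_succ_apply]
    exact (memLp_finsetSum _ fun j _ => (ih j).const_mul _).add (hn.memLp t i)

/-- The state is uncorrelated with the present and the future noise. -/
theorem integral_state_mul_noise (hn : IsWhiteNoise μ σ n) {t s : ℕ} (hts : t ≤ s) (i j : V) :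
    ∫ ω, state G ε (fun t i _ => g t i) n x₀ t ω i * n s j ω ∂μ = 0 := by
  induction t generalizing i with
  | zero => simp only [state, integral_const_mul, hn.mean, mul_zero]
  | succ t ih =>
    have hint (k : V) : Integrable (fun ω => ridl G ε (g t) i k *
        (state G ε (fun t i _ => g t i) n x₀ t ω k * n s j ω)) μ :=
      ((memLp_state g ε x₀ hn t k).integrable_mul (hn.memLp s j)).const_mul _
    have hnn : Integrable (fun ω => n t i ω * n s j ω) μ :=
      (hn.memLp t i).integrable_mul (hn.memLp s j)
    simp only [state_succ_apply, add_mul, Finset.sum_mul, mul_assoc]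
    rw [integral_add (integrable_finsetSum _ fun k _ => hint k) hnn,
      integral_finsetSum _ fun k _ => hint k,
      hn.integral_mul, if_neg (by simp; omega), add_zero]
    exact Finset.sum_eq_zero fun k _ => by rw [integral_const_mul, ih (by omega), mul_zero]

theorem integral_state_mul_state (hn : IsWhiteNoise μ σ n) (t : ℕ) (i j : V) :
    ∫ ω, state G ε (fun t i _ => g t i) n x₀ t ω i * state G ε (fun t i _ => g t i) n x₀ t ω j ∂μ
      = stateMoment G ε σ x₀ g t i j := by
  induction t generalizing i j with
  | zero => simp [state, stateMoment, Matrix.vecMulVec_apply]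
  | succ t ih =>
    set x : Ω → V → ℝ := state G ε (fun t i _ => g t i) n x₀ t with hx
    set P := ridl G ε (g t) with hP
    have hxx (k l : V) : Integrable (fun ω => x ω k * x ω l) μ :=
      (memLp_state g ε x₀ hn t k).integrable_mul (memLp_state g ε x₀ hn t l)
    have hxn (k l : V) : Integrable (fun ω => x ω k * n t l ω) μ :=
      (memLp_state g ε x₀ hn t k).integrable_mul (hn.memLp t l)
    have hnn : Integrable (fun ω => n t i ω * n t j ω) μ :=
      (hn.memLp t i).integrable_mul (hn.memLp t j)
    have hexp (ω : Ω) : state G ε (fun t i _ => g t i) n x₀ (t + 1) ω i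
          * state G ε (fun t i _ => g t i) n x₀ (t + 1) ω j
        = ∑ k, ∑ l, P i k * P j l * (x ω k * x ω l) + ∑ k, P i k * (x ω k * n t j ω)
          + ∑ l, P j l * (x ω l * n t i ω) + n t i ω * n t j ω := by
      rw [state_succ_apply, state_succ_apply, add_mul, mul_add, mul_add, Finset.sum_mul_sum,
        Finset.sum_mul, Finset.mul_sum, ← add_assoc]
      congr 2
      · congr 1
        · exact Finset.sum_congr rfl fun k _ => Finset.sum_congr rfl fun l _ => by ring
        · exact Finset.sum_congr rfl fun k _ => by ring
      · exact Finset.sum_congr rfl fun k _ => by ring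
    have hi1 : Integrable (fun ω => ∑ k, ∑ l, P i k * P j l * (x ω k * x ω l)) μ :=
      integrable_finsetSum _ fun k _ => integrable_finsetSum _ fun l _ => (hxx k l).const_mul _
    have hi2 (i j : V) : Integrable (fun ω => ∑ k, P i k * (x ω k * n t j ω)) μ :=
      integrable_finsetSum _ fun k _ => (hxn k j).const_mul _
    have hz (i j : V) : ∫ ω, ∑ k, P i k * (x ω k * n t j ω) ∂μ = 0 := by
      rw [integral_finsetSum _ fun k _ => (hxn k j).const_mul _]
      exact Finset.sum_eq_zero fun k _ => by
        rw [integral_const_mul, integral_state_mul_noise g ε x₀ hn le_rfl, mul_zero]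
    have hi12 : Integrable (fun ω => ∑ k, ∑ l, P i k * P j l * (x ω k * x ω l)
        + ∑ k, P i k * (x ω k * n t j ω)) μ := hi1.add (hi2 i j)
    have hi122 : Integrable (fun ω => ∑ k, ∑ l, P i k * P j l * (x ω k * x ω l)
        + ∑ k, P i k * (x ω k * n t j ω) + ∑ l, P j l * (x ω l * n t i ω)) μ :=
      hi12.add (hi2 j i)
    simp only [hexp]
    rw [integral_add hi122 hnn, integral_add hi12 (hi2 j i), integral_add hi1 (hi2 i j), hz, hz,
      hn.integral_mul, add_zero, add_zero,
      integral_finsetSum _ fun k _ => integrable_finsetSum _ fun l _ => (hxx k l).const_mul _]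
    have hPs (k l : V) : P k l = P l k := congrFun (congrFun (transpose_ridl G ε (g t)) l) k
    simp only [stateMoment, Matrix.add_apply, Matrix.smul_apply, Matrix.one_apply, smul_eq_mul,
      mul_ite, mul_one, mul_zero, Prod.mk.injEq, true_and]
    congr 1
    simp only [Matrix.mul_apply, Finset.sum_mul]
    rw [Finset.sum_comm]
    refine Finset.sum_congr rfl fun k _ => ?_
    rw [integral_finsetSum _ fun l _ => (hxx k l).const_mul _]
    refine Finset.sum_congr rfl fun l _ => ?_
    rw [integral_const_mul, ih, hPs j l]
    ring

end

section

variable {V : Type*} [Fintype V] [DecidableEq V] {G : SimpleGraph V} [DecidableRel G.Adj]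

/-! ### Averaging over the noise and over the activations -/

theorem stateMoment_congr (ε σ : ℝ) (x₀ : V → ℝ) {g g' : ℕ → V → ℝ} {t : ℕ}
    (h : ∀ s < t, g s = g' s) : stateMoment G ε σ x₀ g t = stateMoment G ε σ x₀ g' t := by
  induction t with
  | zero => rfl
  | succ t ih => rw [stateMoment, stateMoment, h t t.lt_succ_self, ih fun s hs => h s (by omega)]

@[fun_prop]
theorem continuous_stateMoment (ε σ : ℝ) (x₀ : V → ℝ) (t : ℕ) :
    Continuous fun g : ℕ → V → ℝ => stateMoment G ε σ x₀ g t := by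
  induction t with
  | zero => exact continuous_const
  | succ t ih =>
    simp only [stateMoment]
    fun_prop

variable {Ω : Type*} [MeasurableSpace Ω]

omit [MeasurableSpace Ω] in
theorem state_eq_of_eq {Ω' : Type*} {γ n : ℕ → V → Ω → ℝ} {γ' n' : ℕ → V → Ω' → ℝ} {ω : Ω} {ω' : Ω'}
    (hγ : ∀ t i, γ t i ω = γ' t i ω') (hn : ∀ t i, n t i ω = n' t i ω') (ε : ℝ) (x₀ : V → ℝ)
    (t : ℕ) : state G ε γ n x₀ t ω = state G ε γ' n' x₀ t ω' := by
  induction t with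
  | zero => rfl
  | succ t ih => simp only [state, ih, hγ, hn]

/-- The state is a continuous function of the values of all activations and noises, which are taken
here as the two coordinates of the sample space. -/
theorem continuous_state_eval (ε : ℝ) (x₀ : V → ℝ) (t : ℕ) :
    Continuous (state G ε (fun t i (q : (ℕ × V → ℝ) × (ℕ × V → ℝ)) => q.1 (t, i))
      (fun t i q => q.2 (t, i)) x₀ t) := by
  induction t with
  | zero => exact continuous_const
  | succ t ih =>
    simp only [state]
    fun_prop

omit [DecidableEq V] in
theorem continuous_sqDeviation : Continuous (sqDeviation : (V → ℝ) → ℝ) := by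
  unfold sqDeviation
  fun_prop

omit [DecidableEq V] in
theorem sqDeviation_nonneg (x : V → ℝ) : 0 ≤ sqDeviation x :=
  Finset.sum_nonneg fun _ _ => sq_nonneg _

theorem sqDeviation_eq_sum [Nonempty V] (x : V → ℝ) :
    sqDeviation x = ∑ i, ∑ j, centering V i j * (x j * x i) := by
  simp only [sqDeviation_eq, dotProduct, Matrix.mulVec, Finset.mul_sum]
  exact Finset.sum_congr rfl fun i _ => Finset.sum_congr rfl fun j _ => by ring

variable {μ : Measure Ω} [IsProbabilityMeasure μ] {p : unitInterval} {γ n : ℕ → V → Ω → ℝ} {σ : ℝ}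

theorem integrable_sqDeviation_of_deterministic [Nonempty V] (hn : IsWhiteNoise μ σ n)
    (g : ℕ → V → ℝ) (ε : ℝ) (x₀ : V → ℝ) (t : ℕ) :
    Integrable (fun ω => sqDeviation (state G ε (fun t i _ => g t i) n x₀ t ω)) μ := by
  simp only [sqDeviation_eq_sum]
  exact integrable_finsetSum _ fun i _ => integrable_finsetSum _ fun j _ =>
    ((memLp_state g ε x₀ hn t j).integrable_mul (memLp_state g ε x₀ hn t i)).const_mul _

theorem integral_sqDeviation_of_deterministic [Nonempty V] (hn : IsWhiteNoise μ σ n)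
    (g : ℕ → V → ℝ) (ε : ℝ) (x₀ : V → ℝ) (t : ℕ) :
    ∫ ω, sqDeviation (state G ε (fun t i _ => g t i) n x₀ t ω) ∂μ
      = (centering V * stateMoment G ε σ x₀ g t).trace := by
  have hint (i j : V) : Integrable (fun ω => centering V i j *
      (state G ε (fun t i _ => g t i) n x₀ t ω j * state G ε (fun t i _ => g t i) n x₀ t ω i)) μ :=
    ((memLp_state g ε x₀ hn t j).integrable_mul (memLp_state g ε x₀ hn t i)).const_mul _
  simp only [sqDeviation_eq_sum]
  rw [integral_finsetSum _ fun i _ => integrable_finsetSum _ fun j _ => hint i j]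
  simp only [Matrix.trace, Matrix.diag_apply, Matrix.mul_apply]
  refine Finset.sum_congr rfl fun i _ => ?_
  rw [integral_finsetSum _ fun j _ => hint i j]
  refine Finset.sum_congr rfl fun j _ => ?_
  rw [integral_const_mul, integral_state_mul_state g ε x₀ hn]

omit [Fintype V] [DecidableEq V] [IsProbabilityMeasure μ] in
theorem IsActivation.aemeasurable (hγ : IsActivation μ p γ) (t : ℕ) (i : V) :
    AEMeasurable (γ t i) μ :=
  (hγ.law t i).aemeasurable

omit [DecidableEq V] in
theorem IsActivation.integrable_comp (hγ : IsActivation μ p γ) {f : (ℕ × V → ℝ) → ℝ}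
    (hf : Continuous f) : Integrable (fun ω => f fun ti => γ ti.1 ti.2 ω) μ := by
  refine integrable_comp_of_continuous (g := fun ω (ti : ℕ × V) => γ ti.1 ti.2 ω)
    (fun ti => hγ.aemeasurable _ _) (fun ti => ?_) hf
  have h := ae_bernoulliMeasure_mem_Icc p
  rw [← (hγ.law ti.1 ti.2).map_eq] at h
  exact ae_of_ae_map (hγ.aemeasurable _ _) h

theorem IsActivation.integrable_stateMoment (hγ : IsActivation μ p γ) (ε : ℝ) (x₀ : V → ℝ) (t : ℕ)
    (i j : V) :
    Integrable (fun ω => stateMoment G ε σ x₀ (fun t i => γ t i ω) t i j) μ :=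
  hγ.integrable_comp (f := fun g => stateMoment G ε σ x₀ (fun t i => g (t, i)) t i j)
    (by fun_prop)

/-- As the noise is independent of the activations, the mean over both is computed by first
averaging over the noise with the activations frozen. -/
theorem integral_sqDeviation [Nonempty V] (hγ : IsActivation μ p γ) (hn : IsWhiteNoise μ σ n)
    (hind : IndepFun (fun ω (ti : ℕ × V) => γ ti.1 ti.2 ω) (fun ω (ti : ℕ × V) => n ti.1 ti.2 ω) μ)
    (ε : ℝ) (x₀ : V → ℝ) (t : ℕ) :
    Integrable (fun ω => sqDeviation (state G ε γ n x₀ t ω)) μ ∧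
    ∫ ω, sqDeviation (state G ε γ n x₀ t ω) ∂μ
      = ∫ ω, (centering V * stateMoment G ε σ x₀ (fun t i => γ t i ω) t).trace ∂μ := by
  set Γ : Ω → ℕ × V → ℝ := fun ω ti => γ ti.1 ti.2 ω with hΓ
  set N : Ω → ℕ × V → ℝ := fun ω ti => n ti.1 ti.2 ω with hN
  have hΓm : AEMeasurable Γ μ := aemeasurable_pi_lambda _ fun ti => hγ.aemeasurable _ _
  have hNm : AEMeasurable N μ := aemeasurable_pi_lambda _ fun ti => (hn.memLp _ _).aemeasurable
  set F : (ℕ × V → ℝ) × (ℕ × V → ℝ) → ℝ := fun q => sqDeviation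
    (state G ε (fun t i (q : (ℕ × V → ℝ) × (ℕ × V → ℝ)) => q.1 (t, i))
      (fun t i q => q.2 (t, i)) x₀ t q) with hF
  have hFc : Continuous F := continuous_sqDeviation.comp (continuous_state_eval ε x₀ t)
  have hFm (ν : Measure ((ℕ × V → ℝ) × (ℕ × V → ℝ))) : AEStronglyMeasurable F ν :=
    hFc.measurable.aestronglyMeasurable
  have hFg (g : ℕ × V → ℝ) (ν : Measure (ℕ × V → ℝ)) :
      AEStronglyMeasurable (fun m => F (g, m)) ν :=
    (hFc.comp (by fun_prop)).measurable.aestronglyMeasurable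
  have hstate (ω : Ω) : sqDeviation (state G ε γ n x₀ t ω) = F (Γ ω, N ω) := by
    refine congrArg sqDeviation ?_
    apply state_eq_of_eq <;> exact fun _ _ => rfl
  have hfrozen (g : ℕ × V → ℝ) (ω : Ω) : F (g, N ω)
      = sqDeviation (state G ε (fun t i _ => g (t, i)) n x₀ t ω) := by
    refine congrArg sqDeviation ?_
    apply state_eq_of_eq <;> exact fun _ _ => rfl
  have hinner (g : ℕ × V → ℝ) : ∫ m, F (g, m) ∂μ.map N
      = (centering V * stateMoment G ε σ x₀ (fun t i => g (t, i)) t).trace := by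
    rw [integral_map hNm (hFg g _)]
    simp only [hfrozen]
    exact integral_sqDeviation_of_deterministic hn (fun t i => g (t, i)) ε x₀ t
  have hcont : Continuous fun g : ℕ × V → ℝ =>
      (centering V * stateMoment G ε σ x₀ (fun t i => g (t, i)) t).trace := by
    fun_prop
  have hlaw := hind.map_prod_eq_prod_map_map hΓm hNm
  have := Measure.isProbabilityMeasure_map (μ := μ) hΓm
  have := Measure.isProbabilityMeasure_map (μ := μ) hNm
  have hFint : Integrable F ((μ.map Γ).prod (μ.map N)) := by
    rw [integrable_prod_iff (hFm _)]
    refine ⟨.of_forall fun g => ?_, ?_⟩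
    · rw [integrable_map_measure (hFg g _) hNm]
      exact (integrable_sqDeviation_of_deterministic hn (fun t i => g (t, i)) ε x₀ t).congr
        (.of_forall fun ω => (hfrozen g ω).symm)
    · have hnorm (g : ℕ × V → ℝ) : ∫ m, ‖F (g, m)‖ ∂μ.map N
          = (centering V * stateMoment G ε σ x₀ (fun t i => g (t, i)) t).trace := by
        rw [← hinner]
        exact integral_congr_ae (.of_forall fun m => Real.norm_of_nonneg (sqDeviation_nonneg _))
      simp only [hnorm]
      rw [integrable_map_measure hcont.measurable.aestronglyMeasurable hΓm]
      exact hγ.integrable_comp hcont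
  have hpair : AEMeasurable (fun ω => (Γ ω, N ω)) μ := hΓm.prodMk hNm
  simp only [hstate]
  constructor
  · rw [← hlaw] at hFint
    exact (integrable_map_measure (hFm _) hpair).1 hFint
  · rw [← integral_map (φ := fun ω => (Γ ω, N ω)) hpair (hFm _), hlaw, integral_prod _ hFint]
    simp only [hinner]
    rw [integral_map hΓm hcont.measurable.aestronglyMeasurable]

omit [DecidableEq V] in
theorem IsActivation.hasLaw (hγ : IsActivation μ p γ) (t : ℕ) :
    HasLaw (fun ω i => γ t i ω) (activationLaw V p) μ where
  aemeasurable := aemeasurable_pi_lambda _ fun i => hγ.aemeasurable t i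
  map_eq := by
    have h := (hγ.indep.precomp (g := fun i : V => (t, i)) fun i j hij => by simpa using hij)
    rw [(iIndepFun_iff_map_fun_eq_pi_map fun i => hγ.aemeasurable t i).1 h, activationLaw]
    simp only [(hγ.law t _).map_eq]

/-- The activations at time `t` are independent of the past, on which the matrix
`E[x(t) x(t)ᵀ | γ]` depends. -/
theorem IsActivation.integral_mul_stateMoment (hγ : IsActivation μ p γ) (ε : ℝ) (x₀ : V → ℝ)
    (t : ℕ) (k l : V) {f : (V → ℝ) → ℝ} (hf : Continuous f) :
    ∫ ω, f (fun i => γ t i ω) * stateMoment G ε σ x₀ (fun t i => γ t i ω) t k l ∂μ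
      = (∫ g, f g ∂activationLaw V p) *
        ∫ ω, stateMoment G ε σ x₀ (fun t i => γ t i ω) t k l ∂μ := by
  -- `S` indexes the activations at time `t`, and `T` those before it.
  set S : Finset (ℕ × V) := {t} ×ˢ Finset.univ with hS
  set T : Finset (ℕ × V) := Finset.range t ×ˢ Finset.univ with hT
  have hdisj : Disjoint S T := by
    rw [Finset.disjoint_left]
    rintro ⟨s, i⟩ h1 h2
    simp only [hS, hT, Finset.mem_product, Finset.mem_singleton, Finset.mem_range] at h1 h2
    omega
  have hST := hγ.indep.indepFun_finset₀ S T hdisj fun ti => hγ.aemeasurable ti.1 ti.2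
  have hmem (i : V) : (t, i) ∈ S := by simp [hS]
  have hφ : Continuous fun r : S → ℝ => f fun i => r ⟨(t, i), hmem i⟩ := by fun_prop
  have hψ : Continuous fun r : T → ℝ => stateMoment G ε σ x₀
      (fun s i => if h : (s, i) ∈ T then r ⟨(s, i), h⟩ else 0) t k l := by
    have hg : Continuous fun (r : T → ℝ) (s : ℕ) (i : V) =>
        if h : (s, i) ∈ T then r ⟨(s, i), h⟩ else 0 := by
      refine continuous_pi fun s => continuous_pi fun i => ?_
      split_ifs <;> fun_prop
    exact ((continuous_stateMoment ε σ x₀ t).comp hg).matrix_elem k l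
  have hind := hST.comp hφ.measurable hψ.measurable
  have hpast (ω : Ω) : stateMoment G ε σ x₀ (fun t i => γ t i ω) t
      = stateMoment G ε σ x₀ (fun s i => if (s, i) ∈ T then γ s i ω else 0) t :=
    stateMoment_congr ε σ x₀ fun s hs => by
      ext i
      simp [hT, hs]
  have hfm : AEStronglyMeasurable (fun ω => f fun i => γ t i ω) μ :=
    (hf.measurable.comp_aemeasurable (hγ.hasLaw t).aemeasurable).aestronglyMeasurable
  have hYm := (hγ.integrable_stateMoment (G := G) (σ := σ) ε x₀ t k l).aestronglyMeasurable
  have hlaw := (hγ.hasLaw t).integral_comp hf.measurable.aestronglyMeasurable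
  rw [← hlaw]
  refine IndepFun.integral_fun_mul_eq_mul_integral ?_ hfm hYm
  simp only [hpast]
  exact hind

variable (G) in
/-- The second-moment matrix `E[x(t) x(t)ᵀ]`, as the mean over the activations of its value for
frozen activations. -/
def meanStateMoment (μ : Measure Ω) (ε σ : ℝ) (γ : ℕ → V → Ω → ℝ) (x₀ : V → ℝ) (t : ℕ) :
    Matrix V V ℝ :=
  Matrix.of fun i j => ∫ ω, stateMoment G ε σ x₀ (fun t i => γ t i ω) t i j ∂μ

theorem meanStateMoment_succ (hγ : IsActivation μ p γ) (ε : ℝ) (x₀ : V → ℝ) (t : ℕ) :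
    meanStateMoment G μ ε σ γ x₀ (t + 1)
      = meanConj G ε p (meanStateMoment G μ ε σ γ x₀ t) + σ ^ 2 • 1 := by
  ext i j
  have hint (k l : V) : Integrable (fun ω => ridl G ε (fun i => γ t i ω) i k
      * ridl G ε (fun i => γ t i ω) l j
      * stateMoment G ε σ x₀ (fun t i => γ t i ω) t k l) μ :=
    hγ.integrable_comp (f := fun g => ridl G ε (fun i => g (t, i)) i k
      * ridl G ε (fun i => g (t, i)) l j * stateMoment G ε σ x₀ (fun t i => g (t, i)) t k l)
      (by fun_prop)
  have hexp (P Y : Matrix V V ℝ) : (P * Y * P) i j = ∑ l, ∑ k, P i k * P l j * Y k l := by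
    simp only [Matrix.mul_apply, Finset.sum_mul]
    exact Finset.sum_congr rfl fun l _ => Finset.sum_congr rfl fun k _ => by ring
  have hsum : Integrable (fun ω => ∑ l, ∑ k, ridl G ε (fun i => γ t i ω) i k
      * ridl G ε (fun i => γ t i ω) l j
      * stateMoment G ε σ x₀ (fun t i => γ t i ω) t k l) μ :=
    integrable_finsetSum _ fun l _ => integrable_finsetSum _ fun k _ => hint k l
  simp only [meanStateMoment, Matrix.of_apply, stateMoment, Matrix.add_apply, meanConj_apply, hexp]
  rw [integral_add hsum (integrable_const _), integral_const, probReal_univ, one_smul,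
    integral_finsetSum _ fun l _ => integrable_finsetSum _ fun k _ => hint k l,
    integral_finsetSum _ fun l _ => integrable_activationLaw p (by fun_prop)]
  congr 1
  refine Finset.sum_congr rfl fun l _ => ?_
  rw [integral_finsetSum _ fun k _ => hint k l,
    integral_finsetSum _ fun k _ => integrable_activationLaw p (by fun_prop)]
  refine Finset.sum_congr rfl fun k _ => ?_
  rw [integral_mul_const]
  exact hγ.integral_mul_stateMoment ε x₀ t k l (f := fun g => ridl G ε g i k * ridl G ε g l j)
    (by fun_prop)

theorem meanStateMoment_eq (hγ : IsActivation μ p γ) (ε : ℝ) (x₀ : V → ℝ) (t : ℕ) :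
    meanStateMoment G μ ε σ γ x₀ t
      = (meanConj G ε p ^ t) (Matrix.vecMulVec x₀ x₀)
        + σ ^ 2 • ∑ s ∈ Finset.range t, (meanConj G ε p ^ s) 1 := by
  induction t with
  | zero =>
    ext i j
    simp [meanStateMoment, stateMoment]
  | succ t ih =>
    rw [meanStateMoment_succ hγ, ih, map_add, map_smul, map_sum, Finset.sum_range_succ']
    simp only [pow_succ', Module.End.mul_apply, pow_zero, Module.End.one_apply, smul_add, add_assoc]

theorem meanSqDeviation_eq [Nonempty V] (hγ : IsActivation μ p γ) (hn : IsWhiteNoise μ σ n)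
    (hind : IndepFun (fun ω (ti : ℕ × V) => γ ti.1 ti.2 ω) (fun ω (ti : ℕ × V) => n ti.1 ti.2 ω) μ)
    (ε : ℝ) (x₀ : V → ℝ) (t : ℕ) :
    meanSqDeviation μ G ε γ n x₀ t = 1 / (Fintype.card V : ℝ) *
      ((centering V * (meanConj G ε p ^ t) (Matrix.vecMulVec x₀ x₀)).trace
        + σ ^ 2 * ∑ s ∈ Finset.range t, (centering V * (meanConj G ε p ^ s) 1).trace) := by
  have hint (i j : V) := (hγ.integrable_stateMoment (G := G) (σ := σ) ε x₀ t i j).const_mul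
    (centering V j i)
  have h : ∫ ω, (centering V * stateMoment G ε σ x₀ (fun t i => γ t i ω) t).trace ∂μ
      = (centering V * meanStateMoment G μ ε σ γ x₀ t).trace := by
    simp only [Matrix.trace, Matrix.diag_apply, Matrix.mul_apply]
    rw [integral_finsetSum _ fun j _ => integrable_finsetSum _ fun i _ => hint i j]
    refine Finset.sum_congr rfl fun j _ => ?_
    rw [integral_finsetSum _ fun i _ => hint i j]
    exact Finset.sum_congr rfl fun i _ => integral_const_mul _ _
  rw [meanSqDeviation, (integral_sqDeviation hγ hn hind ε x₀ t).2, h, meanStateMoment_eq hγ,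
    Matrix.mul_add, Matrix.trace_add, Matrix.mul_smul, Matrix.trace_smul, Matrix.mul_sum,
    Matrix.trace_sum, smul_eq_mul]

/-! ### The noise index -/

variable (G) in
/-- The squared deviation which one unit of isotropic noise causes, added up over all later times:
`∑ₜ tr(Π Mᵗ(I))` with `Π` the centering projection and `M X = E[P X P]`. -/
def noiseGain (ε : ℝ) (p : unitInterval) : ℝ :=
  ∑' t, (centering V * (meanConj G ε p ^ t) 1).trace

theorem tendsto_meanSqDeviation (hG : G.Connected) {ε : ℝ} (hε : 0 < ε)
    (hk : ε * G.maxDegree < 1) (hp : 0 < (p : ℝ)) (hγ : IsActivation μ p γ)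
    (hn : IsWhiteNoise μ σ n)
    (hind : IndepFun (fun ω (ti : ℕ × V) => γ ti.1 ti.2 ω) (fun ω (ti : ℕ × V) => n ti.1 ti.2 ω) μ)
    (x₀ : V → ℝ) :
    Tendsto (meanSqDeviation μ G ε γ n x₀) atTop
      (𝓝 (1 / (Fintype.card V : ℝ) * (σ ^ 2 * noiseGain G ε p))) := by
  have := hG.nonempty
  have hx₀ : (Matrix.vecMulVec x₀ x₀).PosSemidef := by
    simpa using Matrix.posSemidef_vecMulVec_self_star x₀
  have h0 := (lyapunov_meanConj_pow hG hε hk hp hx₀).1.tendsto_atTop_zero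
  have h1 := (lyapunov_meanConj_pow hG hε hk hp .one).1.hasSum.tendsto_sum_nat
  have h2 := (h0.add (h1.const_mul (σ ^ 2))).const_mul (1 / (Fintype.card V : ℝ))
  rw [zero_add] at h2
  exact h2.congr fun t => (meanSqDeviation_eq hγ hn hind ε x₀ t).symm

theorem noiseIndex_eq (hG : G.Connected) {ε : ℝ} (hε : 0 < ε)
    (hk : ε * G.maxDegree < 1) (hp : 0 < (p : ℝ)) (hγ : IsActivation μ p γ)
    (hn : IsWhiteNoise μ σ n)
    (hind : IndepFun (fun ω (ti : ℕ × V) => γ ti.1 ti.2 ω) (fun ω (ti : ℕ × V) => n ti.1 ti.2 ω) μ)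
    (x₀ : V → ℝ) :
    noiseIndex μ G ε γ n x₀ = 1 / (Fintype.card V : ℝ) * (σ ^ 2 * noiseGain G ε p) :=
  (tendsto_meanSqDeviation hG hε hk hp hγ hn hind x₀).limUnder_eq

theorem lowerBound_le (hG : G.Connected) {ε : ℝ} (hε : 0 < ε) (hk : ε * G.maxDegree < 1)
    (hp : 0 < (p : ℝ)) (σ : ℝ) :
    lowerBound G σ p ε ≤ 1 / (Fintype.card V : ℝ) * (σ ^ 2 * noiseGain G ε p) := by
  have := hG.nonempty
  have hN : (0 : ℝ) < Fintype.card V := by exact_mod_cast Fintype.card_pos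
  have h := (lyapunov_meanConj_pow hG hε hk hp .one).2.1
  rw [Matrix.mul_one, trace_lapPinv, ← noiseGain] at h
  have h' : avgResistance G / (2 * p ^ 2 * ε) ≤ noiseGain G ε p / Fintype.card V := by
    rw [div_le_div_iff₀ (by positivity) hN]
    linarith
  calc lowerBound G σ p ε = σ ^ 2 * (avgResistance G / (2 * p ^ 2 * ε)) := by
        rw [lowerBound, div_mul_div_comm, mul_div_assoc]
    _ ≤ σ ^ 2 * (noiseGain G ε p / Fintype.card V) := by gcongr
    _ = _ := by ring

/-- The bound holds with `p ^ 2` in the place of `p ^ 3`, and `p ≤ 1`. -/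
theorem le_upperBound (hG : G.Connected) {ε : ℝ} (hε : 0 < ε) (hk : ε * G.maxDegree < 1)
    (hp : 0 < (p : ℝ)) (σ : ℝ) :
    1 / (Fintype.card V : ℝ) * (σ ^ 2 * noiseGain G ε p) ≤ upperBound G σ p ε := by
  have := hG.nonempty
  have hN : (0 : ℝ) < Fintype.card V := by exact_mod_cast Fintype.card_pos
  have hk' : 0 < 1 - ε * G.maxDegree := by linarith
  have hR := avgResistance_nonneg G
  have h := (lyapunov_meanConj_pow hG hε hk hp .one).2.2
  rw [Matrix.mul_one, trace_lapPinv, ← noiseGain] at h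
  have h' : noiseGain G ε p / Fintype.card V
      ≤ avgResistance G / (2 * p ^ 2 * (1 - ε * G.maxDegree) * ε) := by
    rw [div_le_div_iff₀ hN (by positivity)]
    linarith
  have hp3 : (p : ℝ) ^ 3 ≤ p ^ 2 := pow_le_pow_of_le_one p.2.1 p.2.2 (by norm_num)
  calc 1 / (Fintype.card V : ℝ) * (σ ^ 2 * noiseGain G ε p)
      = σ ^ 2 * (noiseGain G ε p / Fintype.card V) := by ring
    _ ≤ σ ^ 2 * (avgResistance G / (2 * p ^ 2 * (1 - ε * G.maxDegree) * ε)) := by gcongr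
    _ ≤ σ ^ 2 * (avgResistance G / (2 * p ^ 3 * (1 - ε * G.maxDegree) * ε)) := by gcongr
    _ = upperBound G σ p ε := by rw [upperBound, div_mul_div_comm, mul_div_assoc]

theorem lowerBound_eq_mul {σ p ε k : ℝ} (hε : ε * G.maxDegree = k) (hk : k ≠ 0) :
    lowerBound G σ p ε = σ ^ 2 / (2 * p ^ 2 * k) * (G.maxDegree * avgResistance G) := by
  obtain ⟨hε0, hd0⟩ := mul_ne_zero_iff.1 (hε ▸ hk)
  rw [lowerBound, ← hε]
  field_simp

theorem upperBound_eq_mul {σ p ε k : ℝ} (hε : ε * G.maxDegree = k) (hk : k ≠ 0) :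
    upperBound G σ p ε
      = σ ^ 2 / (2 * p ^ 3 * k * (1 - k)) * (G.maxDegree * avgResistance G) := by
  obtain ⟨hε0, hd0⟩ := mul_ne_zero_iff.1 (hε ▸ hk)
  rw [upperBound, hε]
  generalize 1 - k = c
  rw [← hε]
  field_simp

theorem isTheta_of_le_of_le {f g : ℕ → ℝ} {a b : ℝ} (ha : 0 < a) (hg : ∀ m, 0 ≤ g m)
    (h₁ : ∀ m, a * g m ≤ f m) (h₂ : ∀ m, f m ≤ b * g m) : f =Θ[atTop] g := by
  have hf (m : ℕ) : 0 ≤ f m := (mul_nonneg ha.le (hg m)).trans (h₁ m)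
  refine ⟨.of_bound b (.of_forall fun m => ?_), .of_bound a⁻¹ (.of_forall fun m => ?_)⟩
  · rw [Real.norm_of_nonneg (hf m), Real.norm_of_nonneg (hg m)]
    exact h₂ m
  · rw [Real.norm_of_nonneg (hf m), Real.norm_of_nonneg (hg m), inv_mul_eq_div, le_div_iff₀' ha]
    exact h₁ m

end

end NoisyConsensus

end

theorem proposition2 (σ : ℝ) (p : unitInterval) (hp : 0 < (p : ℝ)) :
    -- the noise index is a genuine limit, and it satisfies the two bounds
    (∀ {V : Type*} [Fintype V] [DecidableEq V] {Ω : Type*} [MeasurableSpace Ω]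
      (μ : Measure Ω) [IsProbabilityMeasure μ]
      (G : SimpleGraph V) [DecidableRel G.Adj] (_ : G.Connected)
      (ε : ℝ) (_ : 0 < ε) (_ : ε * G.maxDegree < 1)
      (γ n : ℕ → V → Ω → ℝ)
      (_ : NoisyConsensus.IsActivation μ p γ) (_ : NoisyConsensus.IsWhiteNoise μ σ n)
      (_ : IndepFun (fun ω (ti : ℕ × V) => γ ti.1 ti.2 ω) (fun ω (ti : ℕ × V) => n ti.1 ti.2 ω) μ)
      (x₀ : V → ℝ),
      (∀ t, Integrable
        (fun ω => NoisyConsensus.sqDeviation (NoisyConsensus.state G ε γ n x₀ t ω)) μ) ∧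
      Tendsto (NoisyConsensus.meanSqDeviation μ G ε γ n x₀) atTop
        (𝓝 (NoisyConsensus.noiseIndex μ G ε γ n x₀)) ∧
      NoisyConsensus.lowerBound G σ p ε ≤ NoisyConsensus.noiseIndex μ G ε γ n x₀ ∧
      NoisyConsensus.noiseIndex μ G ε γ n x₀ ≤ NoisyConsensus.upperBound G σ p ε) ∧
    -- asymptotics along graphs of growing order, with `σ`, `p` and `k = ε * d_max` fixed
    (∀ (_ : 0 < σ) (k : ℝ) (_ : 0 < k) (_ : k < 1)
      (V : ℕ → Type*) [∀ m, Fintype (V m)] [∀ m, DecidableEq (V m)]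
      (_ : Tendsto (fun m => Fintype.card (V m)) atTop atTop)
      (Ω : ℕ → Type*) [∀ m, MeasurableSpace (Ω m)]
      (μ : ∀ m, Measure (Ω m)) [∀ m, IsProbabilityMeasure (μ m)]
      (G : ∀ m, SimpleGraph (V m)) [∀ m, DecidableRel (G m).Adj] (_ : ∀ m, (G m).Connected)
      (ε : ℕ → ℝ) (_ : ∀ m, 0 < ε m) (_ : ∀ m, ε m * (G m).maxDegree = k)
      (γ n : ∀ m, ℕ → V m → Ω m → ℝ)
      (_ : ∀ m, NoisyConsensus.IsActivation (μ m) p (γ m))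
      (_ : ∀ m, NoisyConsensus.IsWhiteNoise (μ m) σ (n m))
      (_ : ∀ m, IndepFun (fun ω (ti : ℕ × V m) => γ m ti.1 ti.2 ω)
        (fun ω (ti : ℕ × V m) => n m ti.1 ti.2 ω) (μ m))
      (x₀ : ∀ m, V m → ℝ),
      (∀ m,
        σ ^ 2 / (2 * (p : ℝ) ^ 2 * k) *
            ((G m).maxDegree * NoisyConsensus.avgResistance (G m)) ≤
          NoisyConsensus.noiseIndex (μ m) (G m) (ε m) (γ m) (n m) (x₀ m) ∧
        NoisyConsensus.noiseIndex (μ m) (G m) (ε m) (γ m) (n m) (x₀ m) ≤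
          σ ^ 2 / (2 * (p : ℝ) ^ 3 * k * (1 - k)) *
            ((G m).maxDegree * NoisyConsensus.avgResistance (G m))) ∧
      (fun m => NoisyConsensus.noiseIndex (μ m) (G m) (ε m) (γ m) (n m) (x₀ m)) =Θ[atTop]
        (fun m => ((G m).maxDegree : ℝ) * NoisyConsensus.avgResistance (G m)) ∧
      -- both bounds have the order of growth of the noise index
      (fun m => NoisyConsensus.noiseIndex (μ m) (G m) (ε m) (γ m) (n m) (x₀ m)) =Θ[atTop]
        (fun m => NoisyConsensus.lowerBound (G m) σ p (ε m)) ∧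
      (fun m => NoisyConsensus.noiseIndex (μ m) (G m) (ε m) (γ m) (n m) (x₀ m)) =Θ[atTop]
        (fun m => NoisyConsensus.upperBound (G m) σ p (ε m))) := by
  open NoisyConsensus in
  refine ⟨?_, ?_⟩
  · intro V _ _ Ω _ μ _ G _ hG ε hε hk γ n hγ hn hind x₀
    have := hG.nonempty
    have hJ := noiseIndex_eq hG hε hk hp hγ hn hind x₀
    refine ⟨fun t => (integral_sqDeviation hγ hn hind ε x₀ t).1, ?_, ?_, ?_⟩
    · rw [hJ]
      exact tendsto_meanSqDeviation hG hε hk hp hγ hn hind x₀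
    · rw [hJ]
      exact lowerBound_le hG hε hk hp σ
    · rw [hJ]
      exact le_upperBound hG hε hk hp σ
  · intro hσ k hk0 hk1 V _ _ _ Ω _ μ _ G _ hG ε hε hεk γ n hγ hn hind x₀
    have hkm (m : ℕ) : ε m * (G m).maxDegree < 1 := by rw [hεk]; exact hk1
    have hJ (m : ℕ) := noiseIndex_eq (hG m) (hε m) (hkm m) hp (hγ m) (hn m) (hind m) (x₀ m)
    have hlow (m : ℕ) := lowerBound_le (hG m) (hε m) (hkm m) hp σ
    have hupp (m : ℕ) := le_upperBound (hG m) (hε m) (hkm m) hp σ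
    simp only [← hJ, lowerBound_eq_mul (hεk _) hk0.ne'] at hlow
    simp only [← hJ, upperBound_eq_mul (hεk _) hk0.ne'] at hupp
    have hk' : 0 < 1 - k := by linarith
    have hnn (m : ℕ) : 0 ≤ ((G m).maxDegree : ℝ) * avgResistance (G m) := by
      have := (hG m).nonempty
      exact mul_nonneg (Nat.cast_nonneg _) (avgResistance_nonneg _)
    have hΘ := isTheta_of_le_of_le (by positivity) hnn hlow hupp
    refine ⟨fun m => ⟨hlow m, hupp m⟩, hΘ, ?_, ?_⟩
    · simp only [lowerBound_eq_mul (hεk _) hk0.ne']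
      exact (isTheta_const_mul_right (by positivity)).2 hΘ
    · simp only [upperBound_eq_mul (hεk _) hk0.ne']
      exact (isTheta_const_mul_right (by positivity)).2 hΘ
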